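/- **Definitions.** An *MT-algebra* is a complete boolean algebra $M$ with an operation $\square$ satisfying $\square 1=1$, $\square(a\wedge b)=\square a\wedge\square b$, $\square a\le a$, $\square a\le\square\square a$. Put $\diamond=\neg\square\neg$. The *open* elements are those in the image $\mathcal O(M)$ of $\square$ (a frame), the *closed* ones those in the image $\mathsf C(M)$ of $\diamond$, and the *saturated* elements are the meets of open elements. $M$ is: - *spatial* if it is isomorphic to a powerset $\mathcal P(Y)$ with the interior operator of a topology on $Y$ (a frame is *spatial* if it is isomorphic to the frame $\Omega(Y)$ of opens of a space $Y$); - $T_0$ (resp. $T_{1/2}$, $T_2$) if every element is a join of elements of the form $s\wedge c$ with $s$ saturated and $c$ closed (resp. $u\wedge c$ with $u$ open and $c$ closed; resp. of elements $a$ with $a=\bigwedge\{\diamond u\mid a\le u\in\mathcal O(M)\}$); - *sober* if it is $T_0$ and every join-irreducible element of $\mathsf C(M)$ is $\diamond x$ for some atom $x$ of $M$; - *locally compact* if each $u\in\mathcal O(M)$ is the join of those $v\in\mathcal O(M)$ for which there is a compact $k\in M$ with $v\le k\le u$, where $k$ is *compact* if every family of open elements whose join is above $k$ has a finite subfamily whose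 join is above $k$. A frame $L$ is *subfit* if $a\nleq b$ implies that $a\vee c=1\ne b\vee c$ for some $c$, and *Hausdorff* if $a=\bigvee\{u\mid u\le a,\ u^*\nleq a\}$ for every $a\neq1$, where $u^*$ is the pseudocomplement of $u$. For a frame $L$, a meet $\bigwedge S$ is *strongly exact* if, for every $a\in L$, $s\to a=a$ for all $s\in S$ implies $(\bigwedge S)\to a=a$. Let $\mathsf{Filt_{SE}}(L)$ be the set of (possibly improper) filters of $L$ closed under strongly exact meets, ordered by reverse inclusion, and view $L$ as a subset of it through principal filters; then $R=(\mathsf{Filt_{SE}}(L),L)$ is a Raney extension, that is, a pair $(C,L)$ with $C$ a coframe and $L\subseteq C$ closed under arbitrary joins and finite meets, meet-dense in $C$, and such that $a\wedge\bigvee S=\bigvee\{a\wedge s\mid s\in S\}$ for $S\subseteq L$, $a\in C$. The *Funayama envelope* $\mathscr F R$ of a Raney extension $R=(C,L)$ is the MacNeille completion of the boolean envelope (free boolean extension) of $C$, with $\square$ the composite of the right adjoint of the embedding $L\to\mathscr F R$ with that embedding. **Statement.** Let $X$ be a nonempty locally compact Hausdorff space without isolated points (for example $X=\mathbb R$), let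 $R=(\mathsf{Filt_{SE}}(\Omega(X)),\Omega(X))$, and let $M=\mathscr F R$. Then: 1. $M$ is a locally compact sober $T_0$ MT-algebra which is not spatial. 2. $\mathcal O(M)\cong\Omega(X)$; in particular the frame $\mathcal O(M)$ is spatial. Hence a sober MT-algebra whose frame of opens is spatial need not be spatial. 3. The frame $\mathcal O(M)$ is subfit and Hausdorff, but $M$ is not a $T_{1/2}$-algebra and not a $T_2$-algebra. Hence a $T_0$ MT-algebra whose frame of opens is subfit and Hausdorff need not be $T_2$. -/

import Mathlib

universe u

/-! ## Frames -/

section FrameNotions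

variable (L : Type u) [Order.Frame L]

/-- A frame is spatial if it is isomorphic to the frame of opens of a topological space. -/
def IsSpatialFrame : Prop :=
  ∃ (Y : Type u) (_ : TopologicalSpace Y), Nonempty (L ≃o TopologicalSpace.Opens Y)

/-- `L` is subfit: `a ≰ b` implies that some `c` has `a ⊔ c = ⊤` and `b ⊔ c ≠ ⊤`. -/
def IsSubfitFrame : Prop :=
  ∀ a b : L, ¬ a ≤ b → ∃ c : L, a ⊔ c = ⊤ ∧ b ⊔ c ≠ ⊤

/-- `L` is a Hausdorff frame: every `a ≠ ⊤` is the join of all `w ≤ a` whose pseudocomplement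
`wᶜ` is not below `a`. -/
def IsHausdorffFrame : Prop :=
  ∀ a : L, a ≠ ⊤ → a = sSup {w : L | w ≤ a ∧ ¬ wᶜ ≤ a}

end FrameNotions

/-! ## McKinsey--Tarski algebras -/

/-- An MT-algebra: a complete boolean algebra with an interior operator. -/
class MTAlgebra (M : Type u) extends CompleteBooleanAlgebra M where
  /-- The interior operator. -/
  box : M → M
  box_top : box ⊤ = ⊤
  box_inf : ∀ a b : M, box (a ⊓ b) = box a ⊓ box b
  box_le : ∀ a : M, box a ≤ a
  box_le_box_box : ∀ a : M, box a ≤ box (box a)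

namespace MTAlgebra

variable (M : Type u) [MTAlgebra M]

/-- The open elements. -/
def opens : Set M := Set.range (box : M → M)

variable {M}

/-- The closure operator. -/
def diamond (a : M) : M := (box aᶜ)ᶜ

variable (M)

/-- The closed elements. -/
def closeds : Set M := Set.range (diamond : M → M)

/-- The saturated elements: the meets of open elements. -/
def saturateds : Set M := {a | ∃ S ⊆ opens M, a = sInf S}

variable {M}

theorem box_mono {a b : M} (h : a ≤ b) : box a ≤ box b := by
  have h1 := box_inf a b
  rw [inf_eq_left.2 h] at h1
  rw [h1]
  exact inf_le_right

theorem box_eq_of_mem {a : M} (h : a ∈ opens M) : box a = a := by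
  obtain ⟨b, rfl⟩ := h
  exact le_antisymm (box_le _) (box_le_box_box b)

variable (M)

/-- The frame `O(M)` of open elements, ordered as a subset of `M`. -/
def OpenFrame : Type u := {a : M // a ∈ opens M}

namespace OpenFrame

instance : PartialOrder (OpenFrame M) := inferInstanceAs (PartialOrder {a : M // a ∈ opens M})

/-- The interior operator, as the right adjoint of the inclusion `O(M) → M`. -/
def coinsertion :
    GaloisCoinsertion (fun a : OpenFrame M => a.1) (fun a : M => (⟨box a, a, rfl⟩ : OpenFrame M)) :=
  GaloisCoinsertion.monotoneIntro (fun _ _ h => box_mono h) (fun _ _ h => h)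
    (fun a => box_le a) (fun a => Subtype.ext (box_eq_of_mem a.2))

instance : CompleteLattice (OpenFrame M) := (coinsertion M).liftCompleteLattice

instance : Order.Frame (OpenFrame M) :=
  Order.Frame.ofMinimalAxioms <|
    Function.frameMinimalAxioms (β := M) Order.Frame.MinimalAxioms.of (fun a => a.1)
      Iff.rfl
      (fun a b => by
        change box (a.1 ⊓ b.1) = a.1 ⊓ b.1
        rw [box_inf, box_eq_of_mem a.2, box_eq_of_mem b.2])
      (fun s => (coinsertion M).gc.l_sSup)

end OpenFrame

/-- An MT-algebra is spatial if it is isomorphic to a powerset algebra `P(Y)` with the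
interior operator of a topology on `Y`. -/
def IsSpatial : Prop :=
  ∃ (Y : Type u) (_ : TopologicalSpace Y) (f : M ≃o Set Y), ∀ a : M, f (box a) = interior (f a)

variable {M}

/-- `S` is join-dense: every element is a join of elements of `S`. -/
def IsJoinDense (S : Set M) : Prop := ∀ a : M, ∃ T ⊆ S, a = sSup T

/-- `a = s ∧ c` with `s` saturated and `c` closed. -/
def IsT0Element (a : M) : Prop := ∃ s ∈ saturateds M, ∃ c ∈ closeds M, a = s ⊓ c

/-- `a = w ∧ c` with `w` open and `c` closed. -/
def IsTHalfElement (a : M) : Prop := ∃ w ∈ opens M, ∃ c ∈ closeds M, a = w ⊓ c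

/-- `a` is the meet of the closures of the open elements above it. -/
def IsT2Element (a : M) : Prop := a = sInf {b | ∃ w ∈ opens M, a ≤ w ∧ b = diamond w}

variable (M)

/-- `T₀`-algebras. -/
def IsT0 : Prop := IsJoinDense {a : M | IsT0Element a}

/-- `T_{1/2}`-algebras. -/
def IsTHalf : Prop := IsJoinDense {a : M | IsTHalfElement a}

/-- `T₂`-algebras. -/
def IsT2 : Prop := IsJoinDense {a : M | IsT2Element a}

variable {M}

/-- A join-irreducible element of the lattice of closed elements. -/
def IsIrreducibleClosed (c : M) : Prop :=
  c ∈ closeds M ∧ c ≠ ⊥ ∧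
    ∀ a ∈ closeds M, ∀ b ∈ closeds M, c = a ⊔ b → c = a ∨ c = b

variable (M)

/-- Sober MT-algebras: `T₀`, and every join-irreducible closed element is the closure of an
atom. -/
def IsSober : Prop :=
  IsT0 M ∧ ∀ c : M, IsIrreducibleClosed c → ∃ x : M, IsAtom x ∧ c = diamond x

variable {M}

/-- Compact elements: every cover by open elements has a finite subcover. -/
def IsCompactElt (k : M) : Prop :=
  ∀ S ⊆ opens M, k ≤ sSup S → ∃ T ⊆ S, T.Finite ∧ k ≤ sSup T

/-- `a ⊲ b`: there is a compact `k` with `a ≤ k ≤ b`. -/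
def CompactlyBelow (a b : M) : Prop := ∃ k : M, IsCompactElt k ∧ a ≤ k ∧ k ≤ b

variable (M)

/-- Locally compact MT-algebras. -/
def IsLocallyCompact : Prop :=
  ∀ w ∈ opens M, w = sSup {v | v ∈ opens M ∧ CompactlyBelow v w}

end MTAlgebra

/-! ## Raney extensions -/

/-- A Raney extension `(C, L)`: a subset `L` of a coframe `C`, closed under arbitrary joins and
finite meets, all of whose joins are exact in `C`, and which is meet-dense in `C`. -/
structure RaneyExtension (C : Type u) [Order.Coframe C] where
  /-- The subset `L` of `C`. -/
  carrier : Set C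
  sSup_mem : ∀ S ⊆ carrier, sSup S ∈ carrier
  top_mem : ⊤ ∈ carrier
  inf_mem : ∀ a ∈ carrier, ∀ b ∈ carrier, a ⊓ b ∈ carrier
  exact : ∀ S ⊆ carrier, ∀ a : C, a ⊓ sSup S = sSup {b | ∃ s ∈ S, b = a ⊓ s}
  meet_dense : ∀ a : C, ∃ S ⊆ carrier, a = sInf S

/-! ## The boolean envelope of a bounded distributive lattice -/

section BooleanEnvelope

variable (C : Type u) [DistribLattice C]

/-- The prime spectrum of a bounded distributive lattice. -/
abbrev PrimeIdeals : Type u := {I : Order.Ideal C // I.IsPrime}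

variable {C}

/-- The Stone map `a ↦ {I prime | a ∉ I}`. -/
def stoneMap (a : C) : Set (PrimeIdeals C) := {I | a ∉ I.1}

variable (C)

/-- The boolean envelope (free boolean extension): the boolean algebra of sets of prime ideals
generated by the image of the Stone map, which is an embedding of bounded lattices if `C` has bounds. -/
abbrev BooleanEnvelope : Type u :=
  BooleanSubalgebra.closure (Set.range (stoneMap (C := C)))

variable {C}

/-- The embedding of `C` into its boolean envelope. -/
def toBooleanEnvelope (a : C) : BooleanEnvelope C :=
  ⟨stoneMap a, BooleanSubalgebra.subset_closure ⟨a, rfl⟩⟩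

theorem stoneMap_subset {a b : C} : stoneMap a ⊆ stoneMap b ↔ a ≤ b := by
  constructor
  · intro h
    by_contra hab
    have hd : Disjoint ((Order.PFilter.principal a : Order.PFilter C) : Set C)
        ((Order.Ideal.principal b : Order.Ideal C) : Set C) := by
      rw [Set.disjoint_left]
      intro x hx hx'
      exact hab (le_trans hx hx')
    obtain ⟨J, hJ, hbJ, hJa⟩ := DistribLattice.prime_ideal_of_disjoint_filter_ideal hd
    have h1 : (⟨J, hJ⟩ : PrimeIdeals C) ∈ stoneMap a := fun hmem =>
      Set.disjoint_left.1 hJa (show a ∈ Order.PFilter.principal a from le_refl a) hmem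
    exact h h1 (hbJ (show b ∈ Order.Ideal.principal b from le_refl b))
  · intro h I hI hb
    exact hI (I.1.lower h hb)

theorem stoneMap_inf (a b : C) : stoneMap (a ⊓ b) = stoneMap a ∩ stoneMap b := by
  apply Set.Subset.antisymm
  · exact Set.subset_inter (stoneMap_subset.2 inf_le_left) (stoneMap_subset.2 inf_le_right)
  · rintro I ⟨ha, hb⟩ hab
    rcases I.2.mem_or_mem hab with h | h
    · exact ha h
    · exact hb h

theorem stoneMap_sup (a b : C) : stoneMap (a ⊔ b) = stoneMap a ∪ stoneMap b := by
  apply Set.Subset.antisymm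
  · intro I hI
    by_contra hcon
    simp only [stoneMap, Set.mem_union, Set.mem_ofPred_eq, not_or, not_not] at hcon
    exact hI (Order.Ideal.sup_mem hcon.1 hcon.2)
  · exact Set.union_subset (stoneMap_subset.2 le_sup_left) (stoneMap_subset.2 le_sup_right)

theorem toBooleanEnvelope_le {a b : C} :
    toBooleanEnvelope a ≤ toBooleanEnvelope b ↔ a ≤ b :=
  stoneMap_subset

theorem toBooleanEnvelope_inf (a b : C) :
    toBooleanEnvelope (a ⊓ b) = toBooleanEnvelope a ⊓ toBooleanEnvelope b :=
  Subtype.ext (stoneMap_inf a b)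

variable [BoundedOrder C]

theorem stoneMap_top : stoneMap (⊤ : C) = Set.univ := by
  apply Set.eq_univ_of_forall
  intro I hI
  have := I.2.toIsProper
  exact Order.Ideal.IsProper.top_notMem this hI

theorem stoneMap_bot : stoneMap (⊥ : C) = ∅ := by
  apply Set.eq_empty_of_forall_notMem
  intro I hI
  exact hI (Order.Ideal.bot_mem I.1)

theorem toBooleanEnvelope_top : toBooleanEnvelope (⊤ : C) = ⊤ :=
  Subtype.ext stoneMap_top

end BooleanEnvelope

/-! ## The MacNeille completion of a boolean algebra -/

section MacNeille

variable {B : Type u} [BooleanAlgebra B]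

/-- The complement of a cut in a boolean algebra. -/
def DedekindCut.complement (A : DedekindCut B) : DedekindCut B where
  extent := {b | bᶜ ∈ A.right}
  intent := {b | bᶜ ∈ A.left}
  upperPolar_extent := by
    ext c
    rw [upperPolar_le, mem_upperBounds, Set.mem_ofPred_eq, ← A.lowerBounds_right, mem_lowerBounds]
    constructor
    · intro h x hx
      have := h (x := xᶜ) (by simpa using hx)
      exact compl_le_of_compl_le this
    · intro h x hx
      have := h _ hx
      exact compl_le_compl_iff_le.1 this
  lowerPolar_intent := by
    ext c
    rw [lowerPolar_le, mem_lowerBounds, Set.mem_ofPred_eq, ← A.upperBounds_left, mem_upperBounds]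
    constructor
    · intro h x hx
      have := h (x := xᶜ) (by simpa using hx)
      exact le_compl_comm.1 this
    · intro h x hx
      have := h _ hx
      exact compl_le_compl_iff_le.1 this

theorem DedekindCut.principal_le_iff_forall {b : B} {A : DedekindCut B} :
    DedekindCut.principal b ≤ A ↔ ∀ y ∈ A.right, b ≤ y := by
  rw [DedekindCut.principal_le_iff, ← A.lowerBounds_right, mem_lowerBounds]

theorem DedekindCut.inf_le_iff_complement (A X Y : DedekindCut B) :
    A ⊓ X ≤ Y ↔ A ≤ X.complement ⊔ Y := by
  constructor
  · intro h a ha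
    change a ∈ (X.complement ⊔ Y).left
    rw [← DedekindCut.lowerBounds_right, mem_lowerBounds]
    rintro z ⟨hz1, hz2⟩
    have h1 : a ⊓ zᶜ ∈ (A ⊓ X).left :=
      ⟨by
        have ha' : a ∈ A.left := ha
        show _ ∈ A.left
        rw [← A.lowerBounds_right] at ha' ⊢; exact fun y hy => inf_le_left.trans (ha' hy),
       by
        have hz1' : zᶜ ∈ X.left := hz1
        show _ ∈ X.left
        rw [← X.lowerBounds_right] at hz1' ⊢; exact fun y hy => inf_le_right.trans (hz1' hy)⟩
    have h2 : a ⊓ zᶜ ≤ z := Concept.rel_extent_intent (h h1) hz2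
    have h3 : a ⊓ zᶜ = ⊥ := le_bot_iff.1 ((le_inf h2 inf_le_right).trans (inf_compl_self z).le)
    exact (sdiff_eq_bot_iff.1 (by rw [sdiff_eq]; exact h3))
  · rintro h w ⟨hwA, hwX⟩
    have hw : w ∈ (X.complement ⊔ Y).left := h hwA
    change w ∈ Y.left
    rw [← Y.lowerBounds_right, mem_lowerBounds]
    intro y hy
    have h1 : y ⊔ wᶜ ∈ (X.complement ⊔ Y).right := by
      constructor
      · change (y ⊔ wᶜ)ᶜ ∈ X.left
        have hwX' : w ∈ X.left := hwX
        rw [← X.lowerBounds_right] at hwX' ⊢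
        intro t ht
        refine le_trans ?_ (hwX' ht)
        rw [compl_sup, compl_compl]
        exact inf_le_right
      · change y ⊔ wᶜ ∈ Y.right
        rw [← Y.upperBounds_left] at hy ⊢
        exact fun t ht => (hy ht).trans le_sup_left
    have h2 : w ≤ y ⊔ wᶜ := Concept.rel_extent_intent hw h1
    calc w ≤ w ⊓ (y ⊔ wᶜ) := le_inf le_rfl h2
      _ = w ⊓ y := by rw [inf_sup_left, inf_compl_self, sup_bot_eq]
      _ ≤ y := inf_le_right

/-- The MacNeille completion of a boolean algebra is a complete boolean algebra (with the order of
cuts). -/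
@[reducible]
def DedekindCut.completeBooleanAlgebra : CompleteBooleanAlgebra (DedekindCut B) where
  __ := (inferInstance : CompleteLattice (DedekindCut B))
  le_sup_inf := by
    intro x y z
    have dist : ∀ a b c : DedekindCut B, a ⊓ (b ⊔ c) ≤ (a ⊓ b) ⊔ (a ⊓ c) := by
      intro a b c
      rw [inf_comm, DedekindCut.inf_le_iff_complement]
      refine sup_le ?_ ?_
      · rw [← DedekindCut.inf_le_iff_complement, inf_comm]; exact le_sup_left
      · rw [← DedekindCut.inf_le_iff_complement, inf_comm]; exact le_sup_right
    exact (DistribLattice.ofInfSupLe dist).le_sup_inf x y z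
  compl := DedekindCut.complement
  inf_compl_le_bot := by
    intro x
    rw [inf_comm, DedekindCut.inf_le_iff_complement]
    exact le_sup_left
  top_le_sup_compl := by
    intro x
    rw [sup_comm, ← DedekindCut.inf_le_iff_complement]
    exact inf_le_right

end MacNeille

/-! ## The Funayama envelope of a Raney extension -/

namespace RaneyExtension

variable {C : Type u} [Order.Coframe C] (R : RaneyExtension C)

/-- The complete boolean algebra underlying the Funayama envelope of `R = (C, L)`: the MacNeille
completion of the boolean envelope of `C`. -/
def FunayamaEnvelope (_R : RaneyExtension C) : Type u := DedekindCut (BooleanEnvelope C)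

instance : CompleteBooleanAlgebra R.FunayamaEnvelope :=
  DedekindCut.completeBooleanAlgebra (B := BooleanEnvelope C)

/-- The embedding of `C` into the Funayama envelope. -/
def embed (a : C) : R.FunayamaEnvelope :=
  (DedekindCut.principal (toBooleanEnvelope a) : DedekindCut (BooleanEnvelope C))

theorem embed_le_embed {a b : C} : R.embed a ≤ R.embed b ↔ a ≤ b :=
  DedekindCut.principal_le_principal.trans toBooleanEnvelope_le

theorem embed_top : R.embed ⊤ = ⊤ := by
  apply top_le_iff.1
  change (⊤ : DedekindCut (BooleanEnvelope C)) ≤ DedekindCut.principal (toBooleanEnvelope ⊤)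
  rw [DedekindCut.le_principal_iff, toBooleanEnvelope_top, ← DedekindCut.upperBounds_left]
  exact fun _ _ => le_top

theorem embed_inf (a b : C) : R.embed (a ⊓ b) = R.embed a ⊓ R.embed b := by
  apply DedekindCut.ext
  change Set.Iic (toBooleanEnvelope (a ⊓ b)) =
    Set.Iic (toBooleanEnvelope a) ∩ Set.Iic (toBooleanEnvelope b)
  rw [toBooleanEnvelope_inf, Set.Iic_inter_Iic]

/-- Since joins in `L` are exact, they are preserved by the embedding into the envelope. -/
theorem embed_sSup_le {S : Set C} (hS : S ⊆ R.carrier) {A : R.FunayamaEnvelope}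
    (h : ∀ s ∈ S, R.embed s ≤ A) : R.embed (sSup S) ≤ A := by
  have key : ∀ y ∈ BooleanSubalgebra.closure (Set.range (stoneMap (C := C))),
      (∀ s ∈ S, Disjoint (stoneMap s) y) → Disjoint (stoneMap (sSup S)) y := by
    intro y hy
    have hsub : IsSublattice (Set.range (stoneMap (C := C))) := by
      refine ⟨?_, ?_⟩
      · rintro _ ⟨a, rfl⟩ _ ⟨b, rfl⟩
        exact ⟨a ⊔ b, stoneMap_sup a b⟩
      · rintro _ ⟨a, rfl⟩ _ ⟨b, rfl⟩
        exact ⟨a ⊓ b, stoneMap_inf a b⟩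
    refine BooleanSubalgebra.closure_sdiff_sup_induction
      (p := fun y _ => (∀ s ∈ S, Disjoint (stoneMap s) y) → Disjoint (stoneMap (sSup S)) y)
      hsub ⟨⊥, stoneMap_bot⟩ ⟨⊤, stoneMap_top⟩ ?_ ?_ y hy
    · rintro _ ⟨a, rfl⟩ _ ⟨b, rfl⟩ hd
      have conv : ∀ c : C, Disjoint (stoneMap c) (stoneMap a \ stoneMap b) ↔ a ⊓ c ≤ b := by
        intro c
        rw [← stoneMap_subset, stoneMap_inf, Set.disjoint_left]
        constructor
        · rintro h I ⟨h1, h2⟩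
          by_contra h3
          exact h h2 ⟨h1, h3⟩
        · rintro h I h1 ⟨h2, h3⟩
          exact h3 (h ⟨h2, h1⟩)
      rw [conv, R.exact S hS a]
      refine sSup_le ?_
      rintro _ ⟨s, hs, rfl⟩
      exact (conv s).1 (hd s hs)
    · intro x _ y _ hx hy hd
      exact Disjoint.sup_right (hx fun s hs => (hd s hs).mono_right le_sup_left)
        (hy fun s hs => (hd s hs).mono_right le_sup_right)
  refine (DedekindCut.principal_le_iff_forall (B := BooleanEnvelope C)).2 ?_
  intro y hy
  have h1 : ∀ s ∈ S, toBooleanEnvelope s ≤ y := fun s hs =>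
    (DedekindCut.principal_le_iff_forall (B := BooleanEnvelope C)).1 (h s hs) y hy
  have h2 := key _ (yᶜ).2 fun s hs => by
    have h3 : (toBooleanEnvelope s).1 ≤ y.1 := h1 s hs
    exact disjoint_compl_right_iff.2 h3
  have h3 : stoneMap (sSup S) ⊆ y.1 := disjoint_compl_right_iff.1 h2
  exact h3

/-- The right adjoint of the embedding of `L` into the Funayama envelope of `R`. -/
def rightAdjoint (A : R.FunayamaEnvelope) : C := sSup {w | w ∈ R.carrier ∧ R.embed w ≤ A}

theorem rightAdjoint_mem (A : R.FunayamaEnvelope) : R.rightAdjoint A ∈ R.carrier :=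
  R.sSup_mem _ fun _ h => h.1

theorem embed_le_iff_le_rightAdjoint {w : C} (hw : w ∈ R.carrier) (A : R.FunayamaEnvelope) :
    R.embed w ≤ A ↔ w ≤ R.rightAdjoint A := by
  constructor
  · exact fun h => le_sSup ⟨hw, h⟩
  · intro h
    exact (R.embed_le_embed.2 h).trans (R.embed_sSup_le (fun _ h => h.1) fun _ h => h.2)

/-- The Funayama envelope of `R` as an MT-algebra: the interior operator is the embedding of `L`
composed with its right adjoint. -/
instance : MTAlgebra R.FunayamaEnvelope where
  box A := R.embed (R.rightAdjoint A)
  box_top := by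
    apply top_le_iff.1
    rw [← R.embed_top, R.embed_le_embed, ← R.embed_le_iff_le_rightAdjoint R.top_mem]
  box_inf A B := by
    rw [← R.embed_inf]
    congr 1
    apply le_antisymm
    · refine sSup_le fun w hw => le_inf ?_ ?_
      · exact (R.embed_le_iff_le_rightAdjoint hw.1 A).1 (hw.2.trans inf_le_left)
      · exact (R.embed_le_iff_le_rightAdjoint hw.1 B).1 (hw.2.trans inf_le_right)
    · have hm := R.inf_mem _ (R.rightAdjoint_mem A) _ (R.rightAdjoint_mem B)
      exact (R.embed_le_iff_le_rightAdjoint hm _).1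
        (le_inf ((R.embed_le_iff_le_rightAdjoint hm A).2 inf_le_left)
          ((R.embed_le_iff_le_rightAdjoint hm B).2 inf_le_right))
  box_le A := (R.embed_le_iff_le_rightAdjoint (R.rightAdjoint_mem A) A).2 le_rfl
  box_le_box_box A := R.embed_le_embed.2
    ((R.embed_le_iff_le_rightAdjoint (R.rightAdjoint_mem A) _).1 le_rfl)

end RaneyExtension

/-! ## The Raney extension of strongly exact filters -/

section StronglyExact

variable {L : Type u} [Order.Frame L]

/-- The meet of `S` is strongly exact: every `a` with `s ⇨ a = a` for all `s ∈ S` satisfies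
`⋀ S ⇨ a = a`. -/
def IsStronglyExactMeet (S : Set L) : Prop :=
  ∀ a : L, (∀ s ∈ S, s ⇨ a = a) → sInf S ⇨ a = a

variable (L)

/-- Strongly exact filters: (possibly improper) filters closed under strongly exact meets. -/
@[ext]
structure StronglyExactFilter where
  /-- The underlying filter. -/
  toPFilter : Order.PFilter L
  sInf_mem : ∀ S : Set L, (∀ s ∈ S, s ∈ toPFilter) → IsStronglyExactMeet S → sInf S ∈ toPFilter

namespace StronglyExactFilter

/-- Strongly exact filters are ordered by reverse inclusion. -/
instance : PartialOrder (StronglyExactFilter L) where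
  le F G := ∀ a : L, a ∈ G.toPFilter → a ∈ F.toPFilter
  le_refl _ _ ha := ha
  le_trans _ _ _ h h' a ha := h a (h' a ha)
  le_antisymm F G h h' := by
    refine StronglyExactFilter.ext (Order.PFilter.ext _ _ (Set.ext fun a => ?_))
    exact ⟨h' a, h a⟩

variable {L}

theorem le_def {F G : StronglyExactFilter L} :
    F ≤ G ↔ ∀ a : L, a ∈ G.toPFilter → a ∈ F.toPFilter := Iff.rfl

/-- A strongly exact filter from a set closed under the relevant operations. -/
def ofSet (s : Set L) (top : ⊤ ∈ s) (inf : ∀ a ∈ s, ∀ b ∈ s, a ⊓ b ∈ s)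
    (up : ∀ a b, a ≤ b → a ∈ s → b ∈ s)
    (sinf : ∀ S ⊆ s, IsStronglyExactMeet S → sInf S ∈ s) : StronglyExactFilter L where
  toPFilter := Order.IsPFilter.toPFilter (F := s) (Order.IsPFilter.of_def ⟨⊤, top⟩
    (fun a ha b hb => ⟨a ⊓ b, inf a ha b hb, inf_le_left, inf_le_right⟩)
    (fun {x y} h hx => up x y h hx))
  sInf_mem := sinf

theorem mem_ofSet {s : Set L} {h1 h2 h3 h4} {a : L} :
    a ∈ (ofSet s h1 h2 h3 h4).toPFilter ↔ a ∈ s := Iff.rfl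

/-- The principal filter of `a`. -/
def principal (a : L) : StronglyExactFilter L where
  toPFilter := Order.PFilter.principal a
  sInf_mem _ hS _ := le_sInf hS

theorem mem_principal {a b : L} : b ∈ (principal a).toPFilter ↔ a ≤ b := Iff.rfl

theorem le_principal {F : StronglyExactFilter L} {a : L} :
    F ≤ principal a ↔ a ∈ F.toPFilter :=
  ⟨fun h => h a le_rfl, fun h _ hb => Order.PFilter.mem_of_le hb h⟩

/-- Joins of strongly exact filters are intersections. -/
instance : SupSet (StronglyExactFilter L) where
  sSup 𝒮 := ofSet {a | ∀ F ∈ 𝒮, a ∈ F.toPFilter} (fun _ _ => Order.PFilter.top_mem)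
    (fun _ ha _ hb F hF => Order.PFilter.inf_mem (ha F hF) (hb F hF))
    (fun _ _ h ha F hF => Order.PFilter.mem_of_le h (ha F hF))
    (fun S hS hse F hF => F.sInf_mem S (fun _ hs => hS hs F hF) hse)

theorem mem_sSup {𝒮 : Set (StronglyExactFilter L)} {a : L} :
    a ∈ (sSup 𝒮).toPFilter ↔ ∀ F ∈ 𝒮, a ∈ F.toPFilter := Iff.rfl

instance : CompleteLattice (StronglyExactFilter L) :=
  completeLatticeOfSup _ fun _ =>
    ⟨fun _ hF _ ha => ha _ hF, fun _ hG _ ha _ hF => hG hF _ ha⟩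

theorem mem_sup {F G : StronglyExactFilter L} {a : L} :
    a ∈ (F ⊔ G).toPFilter ↔ a ∈ F.toPFilter ∧ a ∈ G.toPFilter := by
  constructor
  · exact fun h => ⟨le_def.1 le_sup_left a h, le_def.1 le_sup_right a h⟩
  · rintro ⟨hF, hG⟩
    have : F ⊔ G ≤ sSup {F, G} := sup_le (le_sSup (by simp)) (le_sSup (by simp))
    refine this a (mem_sSup.2 ?_)
    rintro H (rfl | rfl)
    · exact hF
    · exact hG

theorem himp_eq_self_iff {a b : L} : a ⇨ b = b ↔ a ⇨ b ≤ b :=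
  ⟨fun h => h.le, fun h => le_antisymm h le_himp⟩

/-- If the meet of `S` is strongly exact, then so is that of `{s ⊔ f | s ∈ S}`, and it is
`⋀ S ⊔ f`. -/
theorem isStronglyExactMeet_sup {S : Set L} (hS : IsStronglyExactMeet S) (f : L) :
    IsStronglyExactMeet {b | ∃ s ∈ S, b = s ⊔ f} ∧ sInf {b | ∃ s ∈ S, b = s ⊔ f} = sInf S ⊔ f := by
  have hle : sInf S ⊔ f ≤ sInf {b | ∃ s ∈ S, b = s ⊔ f} := by
    refine le_sInf ?_
    rintro _ ⟨s, hs, rfl⟩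
    exact sup_le_sup_right (sInf_le hs) f
  constructor
  · intro b hb
    rw [himp_eq_self_iff]
    refine (himp_le_himp_right hle).trans ?_
    have h1 : sInf S ⇨ ((f ⇨ b) ⇨ b) = (f ⇨ b) ⇨ b := by
      refine hS _ fun s hs => ?_
      have h2 := hb _ ⟨s, hs, rfl⟩
      rw [sup_himp_distrib] at h2
      rw [himp_eq_self_iff, le_himp_iff]
      refine le_trans ?_ h2.le
      refine le_inf ?_ inf_le_right
      rw [himp_left_comm]
      exact himp_inf_le
    rw [sup_himp_distrib, ← le_himp_iff, ← h1]
    exact himp_le_himp_left le_himp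
  · refine le_antisymm ?_ hle
    set t := sInf {b | ∃ s ∈ S, b = s ⊔ f} with ht
    set m := sInf S ⊔ f with hm
    have h1 : sInf S ⇨ (t ⇨ m) = t ⇨ m := by
      refine hS _ fun s hs => ?_
      rw [himp_eq_self_iff, le_himp_iff]
      have h2 : t ≤ s ⊔ f := sInf_le ⟨s, hs, rfl⟩
      calc (s ⇨ t ⇨ m) ⊓ t = (s ⇨ t ⇨ m) ⊓ t ⊓ (s ⊔ f) := by
            rw [inf_assoc, inf_eq_left.2 h2]
        _ ≤ m := by
            rw [inf_sup_left]
            refine sup_le ?_ (inf_le_right.trans le_sup_right)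
            rw [inf_assoc, inf_comm t s, ← inf_assoc, ← le_himp_iff]
            exact himp_inf_le
    have h2 : sInf S ≤ t ⇨ m := le_trans le_sup_left le_himp
    rw [himp_eq_top_iff.2 h2] at h1
    exact himp_eq_top_iff.1 h1.symm

/-- A strongly exact filter is determined by the elements `b` fixed by all its `g ⇨ ·`. -/
theorem mem_of_forall_himp (G : StronglyExactFilter L) {a : L}
    (ha : ∀ b, (∀ g ∈ G.toPFilter, g ⇨ b = b) → a ⇨ b = b) : a ∈ G.toPFilter := by
  have hinf : sInf {s | s ∈ G.toPFilter ∧ a ≤ s} = a := by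
    refine le_antisymm ?_ (le_sInf fun _ h => h.2)
    set t := sInf {s | s ∈ G.toPFilter ∧ a ≤ s} with ht
    have h1 : a ⇨ (t ⇨ a) = t ⇨ a := by
      refine ha _ fun g hg => ?_
      rw [himp_eq_self_iff, le_himp_iff]
      have h2 : t ≤ g ⊔ a := sInf_le ⟨Order.PFilter.mem_of_le le_sup_left hg, le_sup_right⟩
      calc (g ⇨ t ⇨ a) ⊓ t = (g ⇨ t ⇨ a) ⊓ t ⊓ (g ⊔ a) := by
            rw [inf_assoc, inf_eq_left.2 h2]
        _ ≤ a := by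
            rw [inf_sup_left]
            refine sup_le ?_ inf_le_right
            rw [inf_assoc, inf_comm t g, ← inf_assoc, ← le_himp_iff]
            exact himp_inf_le
    rw [himp_eq_top_iff.2 (le_himp : a ≤ t ⇨ a)] at h1
    exact himp_eq_top_iff.1 h1.symm
  rw [← hinf]
  refine G.sInf_mem _ (fun s hs => hs.1) ?_
  rw [IsStronglyExactMeet, hinf]
  intro b hb
  rw [himp_eq_self_iff]
  have h1 : a ⇨ ((a ⇨ b) ⇨ b) = (a ⇨ b) ⇨ b := by
    refine ha _ fun g hg => ?_
    have h2 := hb (g ⊔ a) ⟨Order.PFilter.mem_of_le le_sup_left hg, le_sup_right⟩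
    rw [sup_himp_distrib] at h2
    rw [himp_eq_self_iff, le_himp_iff]
    refine le_trans (le_inf ?_ inf_le_right) h2.le
    rw [himp_left_comm]
    exact himp_inf_le
  rw [himp_left_comm, himp_self] at h1
  exact himp_eq_top_iff.1 h1.symm

/-- The strongly exact filter of all `a` with `a ⇨ b = b` for all `b` in a given set. -/
def fixing (B : Set L) : StronglyExactFilter L :=
  ofSet {a | ∀ b ∈ B, a ⇨ b = b} (fun _ _ => top_himp)
    (fun a ha a' ha' b hb => by rw [← himp_himp, ha' b hb, ha b hb])
    (fun a a' h ha b hb =>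
      himp_eq_self_iff.2 ((himp_le_himp_right h).trans (ha b hb).le))
    (fun _ hS hse b hb => hse b fun s hs => hS hs b hb)

/-- The set of all `a` with `a ⊔ f ∈ G` for all `f ∈ F`. -/
def residual (F G : StronglyExactFilter L) : StronglyExactFilter L :=
  ofSet {a | ∀ f ∈ F.toPFilter, a ⊔ f ∈ G.toPFilter}
    (fun f _ => by rw [top_sup_eq]; exact Order.PFilter.top_mem)
    (fun a ha a' ha' f hf => by
      rw [sup_inf_right]; exact Order.PFilter.inf_mem (ha f hf) (ha' f hf))
    (fun a a' h ha f hf => Order.PFilter.mem_of_le (sup_le_sup_right h f) (ha f hf))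
    (fun S hS hse f hf => by
      obtain ⟨h1, h2⟩ := isStronglyExactMeet_sup hse f
      rw [← h2]
      refine G.sInf_mem _ ?_ h1
      rintro _ ⟨s, hs, rfl⟩
      exact hS hs f hf)

variable (L)

/-- The strongly exact filters of a frame form a coframe. -/
instance : Order.Coframe (StronglyExactFilter L) :=
  Order.Coframe.ofMinimalAxioms
    { iInf_sup_le_sup_sInf := fun F 𝒮 => by
        rw [le_def]
        intro a ha
        obtain ⟨haF, haS⟩ := mem_sup.1 ha
        have h : residual F (⨅ G ∈ 𝒮, F ⊔ G) ≤ sInf 𝒮 := by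
          refine le_sInf fun G hG x hx f hf => ?_
          refine le_def.1 (iInf₂_le (f := fun G _ => F ⊔ G) G hG) _ (mem_sup.2 ⟨?_, ?_⟩)
          · exact Order.PFilter.mem_of_le le_sup_right hf
          · exact Order.PFilter.mem_of_le le_sup_left hx
        have h1 : a ⊔ a ∈ (⨅ G ∈ 𝒮, F ⊔ G).toPFilter := le_def.1 h a haS a haF
        rwa [sup_idem] at h1 }

/-- The Raney extension `(Filt_SE(L), L)`, where `L` is identified with the principal filters. -/
def raney : RaneyExtension (StronglyExactFilter L) where
  carrier := Set.range principal
  sSup_mem S hS := by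
    refine ⟨sSup {a | principal a ∈ S}, le_antisymm ?_ ?_⟩
    · intro a ha
      refine sSup_le fun b hb => ?_
      exact ha _ hb
    · refine sSup_le fun F hF => ?_
      obtain ⟨a, rfl⟩ := hS hF
      exact le_principal.2 (mem_principal.2 (le_sSup hF))
  top_mem := ⟨⊤, le_antisymm le_top (le_principal.2 Order.PFilter.top_mem)⟩
  inf_mem := by
    rintro _ ⟨a, rfl⟩ _ ⟨b, rfl⟩
    refine ⟨a ⊓ b, le_antisymm (le_inf ?_ ?_) ?_⟩
    · exact le_principal.2 (mem_principal.2 inf_le_left)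
    · exact le_principal.2 (mem_principal.2 inf_le_right)
    · exact le_principal.2 (Order.PFilter.inf_mem (le_principal.1 inf_le_left)
        (le_principal.1 inf_le_right))
  exact S hS F := by
    refine le_antisymm ?_ (sSup_le ?_)
    · intro x hx
      refine mem_of_forall_himp _ fun b hb => ?_
      have hF : ∀ f ∈ F.toPFilter, f ⇨ b = b := fun f hf => hb f (le_def.1 inf_le_left f hf)
      have hu : sSup {a | principal a ∈ S} ⇨ b = b := by
        refine hb _ (le_def.1 inf_le_right _ ?_)
        intro G hG
        obtain ⟨a, rfl⟩ := hS hG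
        exact mem_principal.2 (le_sSup hG)
      have key : ∀ a, principal a ∈ S → x ⇨ (a ⇨ b) = a ⇨ b := by
        intro a ha
        have h1 : fixing {a ⇨ b} ≤ F ⊓ principal a := by
          refine le_inf ?_ (le_principal.2 ?_)
          · rintro f hf _ rfl
            change f ⇨ (a ⇨ b) = a ⇨ b
            rw [himp_left_comm, hF f hf]
          · rintro _ rfl
            exact himp_idem
        exact le_def.1 h1 x (mem_sSup.1 hx _ ⟨_, ha, rfl⟩) _ rfl
      rw [himp_eq_self_iff]
      conv_rhs => rw [← hu]
      rw [le_himp_iff, inf_comm, ← le_himp_iff]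
      refine sSup_le fun a ha => ?_
      rw [le_himp_iff, inf_comm, ← le_himp_iff, ← key a ha]
      exact himp_le_himp_left le_himp
    · rintro _ ⟨G, hG, rfl⟩
      exact inf_le_inf_left _ (le_sSup hG)
  meet_dense F := by
    refine ⟨principal '' {a | a ∈ F.toPFilter}, ?_, le_antisymm (le_sInf ?_) ?_⟩
    · rintro _ ⟨a, _, rfl⟩
      exact ⟨a, rfl⟩
    · rintro _ ⟨a, ha, rfl⟩
      exact le_principal.2 ha
    · intro a ha
      exact le_principal.1 (sInf_le ⟨a, ha, rfl⟩)

end StronglyExactFilter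

/-- The Funayama envelope of the Raney extension `(Filt_SE(L), L)`. -/
abbrev StronglyExactEnvelope : Type u := (StronglyExactFilter.raney L).FunayamaEnvelope

end StronglyExact

/-! A strongly exact filter can be thought of as the opens around a sublocale of `X`. Each point `x`
gives its neighbourhood filter `N(x)`, but there is also the filter `D` of dense opens, which
belongs to a nonzero pointless sublocale. The points make `M` look like `X`; `D` is the part of `M`
that no point can see.

General facts about the envelope of `(C, L)`: differences `c ⊓ dᶜ` with `c ∈ C`, `d ∈ C` are
join-dense. As `C` is a coframe, the embedding preserves all meets, and meet-density of `L` allows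
`d` to be taken in `L`; this is `T₀`. An inequality `c ⊓ dᶜ ≤ e` in the envelope means `c ≤ d ⊔ e`
in `C`, so questions about `M` become questions about filters.

Positive part: the open elements are a copy of `Ω(X)`, which is subfit and Hausdorff by separation
of points. Neighbourhood filters of compact sets are compact elements, so local compactness passes
from `X` to `M`. By Hausdorff separation each `N(x)` is an atom and every irreducible closed element
is the complement of some `X ∖ {x}`, which is the closure of `N(x)`; hence `M` is sober.

Negative part: without isolated points every `X ∖ {x}` is dense, so `D` lies below all of them. An
atom of `M` below `D` would concentrate at some `x` while avoiding it
(`not_isAtom_of_le_denseFilter`), so `M` is not atomic, hence not spatial. Likewise a locally closed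
element below `D` contains no point and is zero (`eq_bot_of_isTHalfElement`), so the nonzero `D` is
no join of such elements: `T_{1/2}` fails. `T₂` elements are closed, so `T₂` fails too. -/

/-! ### Transport of frame properties along isomorphisms -/

section FrameIso

variable {L : Type u} {L' : Type u} [Order.Frame L] [Order.Frame L']

theorem IsSubfitFrame.of_orderIso (e : L ≃o L') (h : IsSubfitFrame L) : IsSubfitFrame L' := by
  intro a b hab
  obtain ⟨c, h1, h2⟩ := h (e.symm a) (e.symm b) (fun h => hab (e.symm.le_iff_le.1 h))
  refine ⟨e c, ?_, fun h3 => h2 ?_⟩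
  · rw [← e.apply_symm_apply a, ← map_sup, h1, map_top]
  · apply e.injective
    rw [map_sup, e.apply_symm_apply, h3, map_top]

theorem IsHausdorffFrame.of_orderIso (e : L ≃o L') (h : IsHausdorffFrame L) :
    IsHausdorffFrame L' := by
  intro a ha
  refine le_antisymm ?_ (sSup_le fun w hw => hw.1)
  rw [← e.symm.le_iff_le, h (e.symm a) (fun h1 => ha (by
    rw [← e.apply_symm_apply a, h1, map_top]))]
  refine sSup_le fun w hw => ?_
  rw [← e.symm_apply_apply w, e.symm.le_iff_le]
  refine le_sSup ⟨?_, fun h1 => hw.2 ?_⟩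
  · rw [← e.apply_symm_apply a, e.le_iff_le]; exact hw.1
  · rw [← e.le_iff_le, map_compl, e.apply_symm_apply]; exact h1

end FrameIso

/-! ### Separation properties of the frame of opens -/

namespace TopologicalSpace.Opens

variable {X : Type u} [TopologicalSpace X]

/-- The complement of a point of a `T₁` space. -/
def complSingleton [T1Space X] (x : X) : Opens X := ⟨{x}ᶜ, isOpen_compl_singleton⟩

theorem le_complSingleton_iff [T1Space X] {x : X} {a : Opens X} :
    a ≤ complSingleton x ↔ x ∉ a :=
  ⟨fun h hx => h hx rfl, fun h _ hy hyx => h (Set.mem_singleton_iff.1 hyx ▸ hy)⟩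

/-- The complement of a point is prime: `a ⇨ (X ∖ {x})` is the top if `a` misses `x`, and otherwise
cannot contain `x`. So fixing this open under implication detects membership of `x`, which turns
sets of points into strongly exact filters. -/
theorem himp_complSingleton_iff [T1Space X] {x : X} {a : Opens X} :
    a ⇨ complSingleton x = complSingleton x ↔ x ∈ a := by
  rw [StronglyExactFilter.himp_eq_self_iff, le_complSingleton_iff]
  constructor
  · intro h
    by_contra hx
    rw [himp_eq_top_iff.2 (le_complSingleton_iff.2 hx)] at h
    exact h trivial
  · intro hx h
    exact le_complSingleton_iff.1 (le_refl (complSingleton x))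
      (himp_inf_le (a := a) (b := complSingleton x) ⟨h, hx⟩)

theorem isSubfitFrame [T1Space X] : IsSubfitFrame (Opens X) := by
  intro a b hab
  obtain ⟨x, hxa, hxb⟩ := Set.not_subset.1 hab
  refine ⟨complSingleton x, ?_, fun h => ?_⟩
  · ext y
    by_cases hy : y = x
    · subst hy; simpa using Or.inl hxa
    · exact iff_of_true (Or.inr hy) trivial
  · have : x ∈ b ⊔ complSingleton x := h ▸ trivial
    rcases this with h1 | h1
    · exact hxb h1
    · exact h1 rfl

theorem isHausdorffFrame [T2Space X] : IsHausdorffFrame (Opens X) := by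
  intro a ha
  refine le_antisymm ?_ (sSup_le fun w hw => hw.1)
  obtain ⟨y, hy⟩ : ∃ y, y ∉ a := by
    by_contra! h
    exact ha (top_le_iff.1 fun y _ => h y)
  intro x hx
  obtain ⟨U, V, hU, hV, hxU, hyV, hd⟩ := t2_separation (fun h : x = y => hy (h ▸ hx))
  -- The pseudocomplement of `a ⊓ U` contains `V`, hence the point `y` outside `a`.
  refine mem_sSup.2 ⟨a ⊓ ⟨U, hU⟩, ⟨inf_le_left, fun h => hy (h ?_)⟩, hx, hxU⟩
  have h1 : (⟨V, hV⟩ : Opens X) ≤ (a ⊓ ⟨U, hU⟩)ᶜ := by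
    rw [le_compl_iff_disjoint_right, disjoint_iff_inf_le]
    rintro z ⟨hz1, -, hz2⟩
    exact (Set.disjoint_left.1 hd hz2 hz1).elim
  exact h1 hyV

end TopologicalSpace.Opens

/-! ### Density, `T₀` and atoms in a Funayama envelope -/

namespace RaneyExtension

variable {C : Type u} [Order.Coframe C] (R : RaneyExtension C)

/-- The embedding of the boolean envelope into the Funayama envelope. -/
def ofEnvelope (b : BooleanEnvelope C) : R.FunayamaEnvelope :=
  (DedekindCut.principal b : DedekindCut (BooleanEnvelope C))

theorem ofEnvelope_compl (b : BooleanEnvelope C) : R.ofEnvelope bᶜ = (R.ofEnvelope b)ᶜ := by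
  apply DedekindCut.ext
  change Set.Iic bᶜ = {x | xᶜ ∈ Set.Ici b}
  ext x
  exact le_compl_comm (α := BooleanEnvelope C)

theorem ofEnvelope_inf (a b : BooleanEnvelope C) :
    R.ofEnvelope (a ⊓ b) = R.ofEnvelope a ⊓ R.ofEnvelope b := by
  apply DedekindCut.ext
  change Set.Iic (a ⊓ b) = Set.Iic a ∩ Set.Iic b
  rw [Set.Iic_inter_Iic]

theorem ofEnvelope_sup (a b : BooleanEnvelope C) :
    R.ofEnvelope (a ⊔ b) = R.ofEnvelope a ⊔ R.ofEnvelope b := by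
  apply compl_injective (α := R.FunayamaEnvelope)
  rw [← ofEnvelope_compl, compl_sup, compl_sup, ofEnvelope_inf, ofEnvelope_compl,
    ofEnvelope_compl]

theorem embed_sup (a b : C) : R.embed (a ⊔ b) = R.embed a ⊔ R.embed b := by
  change R.ofEnvelope _ = _
  rw [show toBooleanEnvelope (a ⊔ b) = toBooleanEnvelope a ⊔ toBooleanEnvelope b from
    Subtype.ext (stoneMap_sup a b), ofEnvelope_sup]
  rfl

theorem embed_bot : R.embed ⊥ = ⊥ := by
  have := R.embed_sSup_le (S := ∅) (Set.empty_subset _) (A := ⊥) (by simp)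
  rwa [sSup_empty, le_bot_iff] at this

theorem embed_eq_bot {a : C} : R.embed a = ⊥ ↔ a = ⊥ := by
  rw [← le_bot_iff, ← embed_bot, embed_le_embed, le_bot_iff]

/-- Reduces comparisons of differences in the envelope to the order of `C`. -/
theorem embed_inf_compl_le {c d e : C} :
    R.embed c ⊓ (R.embed d)ᶜ ≤ R.embed e ↔ c ≤ d ⊔ e := by
  rw [← sdiff_eq, sdiff_le_iff, ← embed_sup, embed_le_embed]

/-- The differences of elements of `C` are join-dense in the Funayama envelope. -/
theorem le_of_forall_embed {A B : R.FunayamaEnvelope}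
    (h : ∀ c d : C, R.embed c ⊓ (R.embed d)ᶜ ≤ A → R.embed c ⊓ (R.embed d)ᶜ ≤ B) : A ≤ B := by
  have key : ∀ (y) (hy : y ∈ BooleanSubalgebra.closure (Set.range (stoneMap (C := C)))),
      R.ofEnvelope ⟨y, hy⟩ ≤ A → R.ofEnvelope ⟨y, hy⟩ ≤ B := by
    intro y hy
    have hsub : IsSublattice (Set.range (stoneMap (C := C))) := by
      refine ⟨?_, ?_⟩
      · rintro _ ⟨a, rfl⟩ _ ⟨b, rfl⟩
        exact ⟨a ⊔ b, stoneMap_sup a b⟩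
      · rintro _ ⟨a, rfl⟩ _ ⟨b, rfl⟩
        exact ⟨a ⊓ b, stoneMap_inf a b⟩
    -- The image of `C` is a bounded sublattice, so every element of the envelope it generates is a
    -- finite join of differences.
    refine BooleanSubalgebra.closure_sdiff_sup_induction
      (p := fun y hy => R.ofEnvelope ⟨y, hy⟩ ≤ A → R.ofEnvelope ⟨y, hy⟩ ≤ B)
      hsub ⟨⊥, stoneMap_bot⟩ ⟨⊤, stoneMap_top⟩ ?_ ?_ y hy
    · rintro _ ⟨a, rfl⟩ _ ⟨b, rfl⟩
      have h1 : R.ofEnvelope (toBooleanEnvelope a ⊓ (toBooleanEnvelope b)ᶜ) =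
          R.embed a ⊓ (R.embed b)ᶜ := by
        rw [ofEnvelope_inf, ofEnvelope_compl]; rfl
      have h2 := h a b
      rw [← h1] at h2
      exact h2
    · intro x hx y hy hx' hy' hxy
      have h1 : R.ofEnvelope (⟨x, hx⟩ ⊔ ⟨y, hy⟩) ≤ A := hxy
      rw [ofEnvelope_sup] at h1
      change R.ofEnvelope (⟨x, hx⟩ ⊔ ⟨y, hy⟩) ≤ B
      rw [ofEnvelope_sup]
      exact sup_le (hx' (le_sup_left.trans h1)) (hy' (le_sup_right.trans h1))
  -- A cut is the join of the elements of the boolean envelope below it.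
  intro b hb
  have h1 : R.ofEnvelope b ≤ A := DedekindCut.principal_le_iff.2 hb
  exact DedekindCut.principal_le_iff.1 (key b.1 b.2 h1)

/-- Meets of `C` survive in the envelope because of the coframe law: if a difference of `c` and `d`
lies below each `s ∈ S`, then `c ≤ d ⊔ s` for all `s`, so `c ≤ d ⊔ ⋀ S`. -/
theorem le_embed_sInf {S : Set C} {A : R.FunayamaEnvelope} (h : ∀ s ∈ S, A ≤ R.embed s) :
    A ≤ R.embed (sInf S) := by
  refine R.le_of_forall_embed fun c d hcd => ?_
  rw [embed_inf_compl_le, sup_sInf_eq]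
  exact le_iInf₂ fun s hs => R.embed_inf_compl_le.1 (hcd.trans (h s hs))

/-- Differences of elements of `C` and of `L` are already join-dense. -/
theorem le_of_forall_carrier {A B : R.FunayamaEnvelope}
    (h : ∀ c : C, ∀ d ∈ R.carrier, R.embed c ⊓ (R.embed d)ᶜ ≤ A → R.embed c ⊓ (R.embed d)ᶜ ≤ B) :
    A ≤ B := by
  refine R.le_of_forall_embed fun c d hcd => ?_
  obtain ⟨S, hS, rfl⟩ := R.meet_dense d
  -- The complement of `⋀ S` is the join of the complements of the `s ∈ S`, so it is enough to treat
  -- `c` minus a single `s`. Residuation puts the goal in the form `le_embed_sInf` accepts.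
  rw [inf_comm, ← le_himp_iff, compl_le_iff_compl_le]
  refine R.le_embed_sInf fun s hs => ?_
  rw [compl_le_iff_compl_le, le_himp_iff, inf_comm]
  refine h c s (hS hs) (le_trans ?_ hcd)
  exact inf_le_inf_left _ (compl_le_compl (R.embed_le_embed.2 (sInf_le hs)))

theorem mem_opens_iff {A : R.FunayamaEnvelope} :
    A ∈ MTAlgebra.opens R.FunayamaEnvelope ↔ ∃ w ∈ R.carrier, R.embed w = A := by
  constructor
  · rintro ⟨B, rfl⟩
    exact ⟨_, R.rightAdjoint_mem B, rfl⟩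
  · rintro ⟨w, hw, rfl⟩
    refine ⟨R.embed w, le_antisymm (MTAlgebra.box_le _) ?_⟩
    exact R.embed_le_embed.2 ((R.embed_le_iff_le_rightAdjoint hw _).1 le_rfl)

theorem mem_closeds_iff {A : R.FunayamaEnvelope} :
    A ∈ MTAlgebra.closeds R.FunayamaEnvelope ↔ ∃ w ∈ R.carrier, (R.embed w)ᶜ = A := by
  constructor
  · rintro ⟨B, rfl⟩
    exact ⟨_, R.rightAdjoint_mem Bᶜ, rfl⟩
  · rintro ⟨w, hw, rfl⟩
    refine ⟨(R.embed w)ᶜ, ?_⟩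
    rw [MTAlgebra.diamond, compl_compl, MTAlgebra.box_eq_of_mem (R.mem_opens_iff.2 ⟨w, hw, rfl⟩)]

theorem embed_mem_saturateds (c : C) : R.embed c ∈ MTAlgebra.saturateds R.FunayamaEnvelope := by
  obtain ⟨S, hS, rfl⟩ := R.meet_dense c
  refine ⟨R.embed '' S, ?_, le_antisymm (le_sInf ?_) ?_⟩
  · rintro _ ⟨s, hs, rfl⟩
    exact R.mem_opens_iff.2 ⟨s, hS hs, rfl⟩
  · rintro _ ⟨s, hs, rfl⟩
    exact R.embed_le_embed.2 (sInf_le hs)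
  · exact R.le_embed_sInf fun s hs => sInf_le ⟨s, hs, rfl⟩

/-- The Funayama envelope of a Raney extension is `T₀`. -/
theorem isT0 : MTAlgebra.IsT0 R.FunayamaEnvelope := by
  intro A
  refine ⟨{x | MTAlgebra.IsT0Element x ∧ x ≤ A}, fun x hx => hx.1,
    le_antisymm (R.le_of_forall_carrier fun c d hd h => le_sSup ⟨?_, h⟩) (sSup_le fun x hx => hx.2)⟩
  exact ⟨_, R.embed_mem_saturateds c, _, R.mem_closeds_iff.2 ⟨d, hd, rfl⟩, rfl⟩

/-- Atoms of `C` are atoms of the Funayama envelope. -/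
theorem isAtom_embed {a : C} (ha : IsAtom a) : IsAtom (R.embed a) := by
  refine ⟨fun h => ha.1 (R.embed_eq_bot.1 h), fun A hA => ?_⟩
  by_contra hne
  -- A nonzero difference `c ⊓ dᶜ` below `A` would lie under `a`. Since `a` is an atom of `C`, this
  -- forces `a ≤ c` and `a ⊓ d = ⊥`, so the image of `a` is below `A`.
  refine hA.not_ge (not_not.1 fun hle => hne (le_bot_iff.1 (R.le_of_forall_embed ?_)))
  intro c d hcd
  by_contra hbot
  refine hle (le_trans ?_ hcd)
  have hca : R.embed c ⊓ (R.embed d)ᶜ ≤ R.embed a := hcd.trans hA.le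
  have h1 : R.embed c ⊓ (R.embed d)ᶜ = R.embed (a ⊓ c) ⊓ (R.embed d)ᶜ := by
    rw [embed_inf, inf_assoc, inf_eq_right.2 hca]
  have h2 : ¬ a ⊓ c ≤ d := fun h => hbot (by
    rw [h1, ← R.embed_bot, embed_inf_compl_le, sup_bot_eq]; exact h)
  have h3 : a ≤ c := by
    rcases ha.le_iff.1 (inf_le_left : a ⊓ c ≤ a) with h | h
    · exact (h2 (h ▸ bot_le)).elim
    · exact inf_eq_left.1 h
  have h4 : a ⊓ d = ⊥ := by
    rcases ha.le_iff.1 (inf_le_left : a ⊓ d ≤ a) with h | h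
    · exact h
    · exact (h2 (inf_le_left.trans (inf_eq_left.1 h))).elim
  refine le_inf (R.embed_le_embed.2 h3) ?_
  rw [le_compl_iff_disjoint_right, disjoint_iff, ← embed_inf, h4, embed_bot]

end RaneyExtension

/-! ### The frame of opens and local compactness -/

namespace StronglyExactFilter

open MTAlgebra RaneyExtension

section Frame

variable (L : Type u) [Order.Frame L]

/-- The frame of opens of the envelope of `(Filt_SE(L), L)` is `L`. -/
noncomputable def openFrameIso : L ≃o OpenFrame (StronglyExactEnvelope L) :=
  RelIso.ofSurjective
    (OrderEmbedding.ofMapLEIff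
      (fun a : L => (⟨(raney L).embed (principal a),
        (raney L).mem_opens_iff.2 ⟨_, ⟨a, rfl⟩, rfl⟩⟩ : OpenFrame (StronglyExactEnvelope L)))
      (fun a b => by
        refine ((raney L).embed_le_embed (a := principal a) (b := principal b)).trans ?_
        rw [le_principal, mem_principal]))
    (by
      rintro ⟨A, hA⟩
      obtain ⟨_, ⟨a, rfl⟩, h⟩ := (raney L).mem_opens_iff.1 hA
      exact ⟨a, Subtype.ext h⟩)

end Frame

variable {X : Type u} [TopologicalSpace X]

open TopologicalSpace

/-- The embedding of opens into the envelope preserves joins. -/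
theorem embed_principal_le {W : Opens X} {A : (raney (Opens X)).FunayamaEnvelope}
    (h : ∀ x ∈ W, ∃ V : Opens X, x ∈ V ∧ (raney (Opens X)).embed (principal V) ≤ A) :
    (raney (Opens X)).embed (principal W) ≤ A := by
  refine le_trans ?_ ((raney (Opens X)).embed_sSup_le
    (S := principal '' {V | (raney (Opens X)).embed (principal V) ≤ A}) ?_ ?_)
  · rw [embed_le_embed]
    intro U hU x hx
    obtain ⟨V, hxV, hV⟩ := h x hx
    exact mem_principal.1 (mem_sSup.1 hU _ ⟨V, hV, rfl⟩) hxV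
  · rintro _ ⟨V, _, rfl⟩
    exact ⟨V, rfl⟩
  · rintro _ ⟨V, hV, rfl⟩
    exact hV

/-- The filter of all open neighbourhoods of a set in a `T₁` space. -/
def nhdsSet [T1Space X] (K : Set X) : StronglyExactFilter (Opens X) :=
  fixing (Opens.complSingleton '' K)

theorem mem_nhdsSet [T1Space X] {K : Set X} {W : Opens X} :
    W ∈ (nhdsSet K).toPFilter ↔ K ⊆ W := by
  refine Iff.trans (b := ∀ b ∈ Opens.complSingleton '' K, W ⇨ b = b) Iff.rfl ?_
  rw [Set.forall_mem_image]
  exact forall₂_congr fun x _ => Opens.himp_complSingleton_iff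

/-- The neighbourhood filter of `K` lies below an open exactly when that open contains `K`, so an
open cover of this element is a cover of the set `K`. A finite subcover passes back because the
embedding preserves joins of opens. -/
theorem isCompactElt_embed_nhdsSet [T1Space X] {K : Set X} (hK : IsCompact K) :
    IsCompactElt ((raney (Opens X)).embed (nhdsSet K)) := by
  intro S hS hle
  let 𝒰 : Set (Opens X) := {U | (raney (Opens X)).embed (principal U) ∈ S}
  have h1 : (raney (Opens X)).embed (nhdsSet K) ≤
      (raney (Opens X)).embed (principal (sSup 𝒰)) := by
    refine hle.trans (sSup_le fun A hA => ?_)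
    obtain ⟨_, ⟨U, rfl⟩, rfl⟩ := (raney (Opens X)).mem_opens_iff.1 (hS hA)
    rw [embed_le_embed, le_principal, mem_principal]
    exact le_sSup hA
  rw [embed_le_embed, le_principal, mem_nhdsSet] at h1
  obtain ⟨t, ht, htf, hKt⟩ := hK.elim_finite_subcover_image (b := 𝒰) (c := fun U => (U : Set X))
    (fun U _ => U.isOpen) (fun x hx => by
      obtain ⟨U, hU, hxU⟩ := Opens.mem_sSup.1 (h1 hx)
      exact Set.mem_biUnion hU hxU)
  refine ⟨(fun U => (raney (Opens X)).embed (principal U)) '' t, ?_, htf.image _, ?_⟩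
  · rintro _ ⟨U, hU, rfl⟩
    exact ht hU
  · refine le_trans ((raney (Opens X)).embed_le_embed.2
      (le_principal.2 ((mem_nhdsSet (W := sSup t)).2 ?_))) (embed_principal_le fun x hx => ?_)
    · intro x hx
      obtain ⟨U, hU, hxU⟩ := Set.mem_iUnion₂.1 (hKt hx)
      exact Opens.mem_sSup.2 ⟨U, hU, hxU⟩
    · obtain ⟨U, hU, hxU⟩ := Opens.mem_sSup.1 hx
      exact ⟨U, hxU, le_sSup ⟨U, hU, rfl⟩⟩

/-- For a compact `K ⊆ U`, the neighbourhood filter of `K` interpolates between the interior of `K`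
and `U`. -/
theorem isLocallyCompact [T2Space X] [LocallyCompactSpace X] :
    IsLocallyCompact (StronglyExactEnvelope (Opens X)) := by
  intro w hw
  obtain ⟨_, ⟨U, rfl⟩, rfl⟩ := (raney (Opens X)).mem_opens_iff.1 hw
  refine le_antisymm (embed_principal_le fun x hx => ?_)
    (sSup_le fun v ⟨_, k, _, h1, h2⟩ => h1.trans h2)
  obtain ⟨K, hK, hxK, hKU⟩ := exists_compact_subset U.isOpen hx
  refine ⟨⟨interior K, isOpen_interior⟩, hxK, le_sSup
    ⟨(raney (Opens X)).mem_opens_iff.2 ⟨_, ⟨_, rfl⟩, rfl⟩, _, isCompactElt_embed_nhdsSet hK, ?_, ?_⟩⟩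
  · rw [embed_le_embed]
    intro W hW
    exact mem_principal.2 (interior_subset.trans (mem_nhdsSet.1 hW))
  · rw [embed_le_embed, le_principal, mem_nhdsSet]
    exact hKU

/-! ### Points as atoms, and sobriety -/

theorem eq_bot_iff_bot_mem {L : Type u} [Order.Frame L] {F : StronglyExactFilter L} :
    F = ⊥ ↔ ⊥ ∈ F.toPFilter := by
  constructor
  · rintro rfl
    exact le_principal.1 bot_le
  · exact fun h => le_bot_iff.1 fun a _ => Order.PFilter.mem_of_le bot_le h

/-- The neighbourhood filter of a point of a Hausdorff space is an atom. -/
theorem isAtom_nhdsSet_singleton [T2Space X] (x : X) :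
    IsAtom (nhdsSet ({x} : Set X)) := by
  refine ⟨fun h => ?_, fun G hG => ?_⟩
  · rw [eq_bot_iff_bot_mem, mem_nhdsSet] at h
    exact h rfl
  · obtain ⟨W, hWG, hWx⟩ : ∃ W ∈ G.toPFilter, x ∉ W := by
      by_contra! h
      exact hG.not_ge fun W hW => mem_nhdsSet.2 (Set.singleton_subset_iff.2 (h W hW))
    rw [eq_bot_iff_bot_mem]
    -- It suffices that every `b` fixed by all of `G` is the top. Separating `y ≠ x` by `U ∋ x` and
    -- `V ∋ y`, one has `U ∈ G` and `V ≤ U ⇨ b = b`, so `b` contains `X ∖ {x}`, hence also `W`; then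
    -- `b = W ⇨ b = ⊤`.
    refine mem_of_forall_himp G fun b hb => ?_
    rw [bot_himp, eq_comm, ← top_le_iff]
    have hsub : Opens.complSingleton x ≤ b := by
      intro y hy
      obtain ⟨U, V, hU, hV, hxU, hyV, hd⟩ := t2_separation (fun h : x = y => hy h.symm)
      have hUG : (⟨U, hU⟩ : Opens X) ∈ G.toPFilter :=
        hG.le _ (mem_nhdsSet.2 (Set.singleton_subset_iff.2 hxU))
      rw [← hb _ hUG]
      have h1 : (⟨V, hV⟩ : Opens X) ≤ (⟨U, hU⟩ : Opens X) ⇨ b := by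
        rw [le_himp_iff]
        rintro z ⟨hz1, hz2⟩
        exact (Set.disjoint_left.1 hd hz2 hz1).elim
      exact h1 hyV
    rw [← hb W hWG, himp_eq_top_iff.2 ((Opens.le_complSingleton_iff.2 hWx).trans hsub)]

/-- An open containing `x` lies above the nonzero neighbourhood filter of `x`, while `X ∖ {x}` is
disjoint from it, as this filter is an atom. So `X ∖ {x}` is the largest open disjoint from it. -/
theorem diamond_embed_nhdsSet_singleton [T2Space X] (x : X) :
    diamond ((raney (Opens X)).embed (nhdsSet {x})) =
      ((raney (Opens X)).embed (principal (Opens.complSingleton x)))ᶜ := by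
  rw [diamond, compl_inj_iff]
  have hinf : nhdsSet {x} ⊓ principal (Opens.complSingleton x) = ⊥ := by
    rcases (isAtom_nhdsSet_singleton x).le_iff.1
      (inf_le_left : nhdsSet {x} ⊓ principal (Opens.complSingleton x) ≤ _) with h | h
    · exact h
    · have h1 := mem_nhdsSet.1 (le_principal.1 (inf_eq_left.1 h))
      exact (h1 rfl rfl).elim
  apply le_antisymm
  · have hop : box ((raney (Opens X)).embed (nhdsSet {x}))ᶜ ∈
      opens (StronglyExactEnvelope (Opens X)) := ⟨_, rfl⟩
    obtain ⟨_, ⟨U, rfl⟩, hU⟩ := (raney (Opens X)).mem_opens_iff.1 hop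
    have h1 := box_le ((raney (Opens X)).embed (nhdsSet {x}))ᶜ
    rw [← hU] at h1 ⊢
    rw [embed_le_embed, le_principal, mem_principal, Opens.le_complSingleton_iff]
    intro hx
    have h2 : (raney (Opens X)).embed (nhdsSet {x}) ≤ (raney (Opens X)).embed (principal U) :=
      (raney (Opens X)).embed_le_embed.2
        (le_principal.2 (mem_nhdsSet.2 (Set.singleton_subset_iff.2 hx)))
    have h3 := le_compl_self.1 (h2.trans h1)
    exact (isAtom_nhdsSet_singleton x).1 ((raney (Opens X)).embed_eq_bot.1 h3)
  · have hop := (raney (Opens X)).mem_opens_iff.2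
      ⟨principal (Opens.complSingleton x), ⟨_, rfl⟩, rfl⟩
    rw [← box_eq_of_mem hop]
    apply box_mono
    rw [le_compl_iff_disjoint_left, disjoint_iff, ← embed_inf, hinf, embed_bot]

/-- The envelope of the strongly exact filters of opens of a Hausdorff space is sober. -/
theorem isSober [T2Space X] : IsSober (StronglyExactEnvelope (Opens X)) := by
  refine ⟨(raney (Opens X)).isT0, ?_⟩
  rintro _ ⟨hc, hbot, hirr⟩
  obtain ⟨_, ⟨U, rfl⟩, rfl⟩ := (raney (Opens X)).mem_closeds_iff.1 hc
  obtain ⟨x, hx⟩ : ∃ x, x ∉ U := by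
    by_contra! h
    rw [show U = ⊤ from top_le_iff.1 fun y _ => h y] at hbot
    apply hbot
    rw [compl_eq_bot, ← embed_top]
    exact congrArg _ (top_le_iff.1 (le_principal.2 Order.PFilter.top_mem))
  refine ⟨_, (raney (Opens X)).isAtom_embed (isAtom_nhdsSet_singleton x), ?_⟩
  rw [diamond_embed_nhdsSet_singleton]
  suffices h : U = Opens.complSingleton x by rw [h]
  refine le_antisymm (Opens.le_complSingleton_iff.2 hx) fun y hy => ?_
  by_contra hyU
  -- If `U` missed two points, disjoint neighbourhoods `V`, `W` would give `U = (U ⊔ V) ⊓ (U ⊔ W)`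
  -- with both factors strictly larger, contradicting irreducibility.
  obtain ⟨V, W, hV, hW, hxV, hyW, hd⟩ := t2_separation (fun h : x = y => hy h.symm)
  have hclosed : ∀ Z : Opens X, ((raney (Opens X)).embed (principal Z))ᶜ ∈
      closeds (StronglyExactEnvelope (Opens X)) :=
    fun Z => (raney (Opens X)).mem_closeds_iff.2 ⟨_, ⟨Z, rfl⟩, rfl⟩
  have hle : ∀ Z Z' : Opens X, (raney (Opens X)).embed (principal Z) ≤
      (raney (Opens X)).embed (principal Z') ↔ Z ≤ Z' := fun Z Z' => by
    rw [embed_le_embed, le_principal, mem_principal]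
  have hprin : principal (U ⊔ ⟨V, hV⟩) ⊓ principal (U ⊔ ⟨W, hW⟩) = principal U := by
    refine le_antisymm (le_principal.2 ?_) (le_inf ?_ ?_)
    · have h1 : (U ⊔ ⟨V, hV⟩) ⊓ (U ⊔ ⟨W, hW⟩) ∈
          (principal (U ⊔ ⟨V, hV⟩) ⊓ principal (U ⊔ ⟨W, hW⟩)).toPFilter :=
        Order.PFilter.inf_mem (le_principal.1 inf_le_left) (le_principal.1 inf_le_right)
      refine Order.PFilter.mem_of_le ?_ h1
      rw [← sup_inf_left]
      refine sup_le le_rfl ?_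
      rintro z ⟨hz1, hz2⟩
      exact (Set.disjoint_left.1 hd hz1 hz2).elim
    · exact le_principal.2 (mem_principal.2 le_sup_left)
    · exact le_principal.2 (mem_principal.2 le_sup_left)
  have hsup : ((raney (Opens X)).embed (principal U))ᶜ =
      ((raney (Opens X)).embed (principal (U ⊔ ⟨V, hV⟩)))ᶜ ⊔
      ((raney (Opens X)).embed (principal (U ⊔ ⟨W, hW⟩)))ᶜ := by
    rw [← compl_inf, ← embed_inf, hprin]
  rcases hirr _ (hclosed _) _ (hclosed _) hsup with h | h
  · rw [compl_inj_iff] at h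
    exact hx (((hle _ _).1 h.ge) (Or.inr hxV))
  · rw [compl_inj_iff] at h
    exact hyU (((hle _ _).1 h.ge) (Or.inr hyW))

/-! ### The dense filter, and failure of spatiality and `T_{1/2}` -/

variable (X)

/-- The filter of dense open sets, corresponding to the smallest dense sublocale. -/
def denseFilter : StronglyExactFilter (Opens X) := fixing {⊥}

variable {X}

theorem mem_denseFilter {W : Opens X} : W ∈ (denseFilter X).toPFilter ↔ Wᶜ = ⊥ := by
  refine Iff.trans (b := ∀ b ∈ ({⊥} : Set (Opens X)), W ⇨ b = b) Iff.rfl ?_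
  simp

theorem embed_denseFilter_ne_bot [Nonempty X] :
    (raney (Opens X)).embed (denseFilter X) ≠ ⊥ := by
  rw [Ne, embed_eq_bot, eq_bot_iff_bot_mem, mem_denseFilter, compl_bot]
  exact top_ne_bot

/-- This is where the absence of isolated points enters: the pseudocomplement of `X ∖ {x}` is an
open subset of `{x}`, hence empty. So the dense filter lies below the complement of every point. -/
theorem complSingleton_mem_denseFilter [T1Space X] [PerfectSpace X] (x : X) :
    Opens.complSingleton x ∈ (denseFilter X).toPFilter := by
  rw [mem_denseFilter, ← le_bot_iff]
  intro y hy
  have hd : (Opens.complSingleton x)ᶜ ⊓ Opens.complSingleton x = ⊥ := compl_inf_self _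
  have hsub : (((Opens.complSingleton x)ᶜ : Opens X) : Set X) ⊆ {x} := by
    intro z hz
    by_contra hzx
    have : z ∈ (Opens.complSingleton x)ᶜ ⊓ Opens.complSingleton x := ⟨hz, hzx⟩
    rw [hd] at this
    exact this
  obtain ⟨z, hz, hzx⟩ := (dense_compl_singleton x).inter_open_nonempty _
    ((Opens.complSingleton x)ᶜ).isOpen ⟨y, hy⟩
  exact (hzx (hsub hz)).elim

/-- The opens above an atom form a completely prime filter, which in a Hausdorff space converges to
a point `x`; but an atom below the dense filter also lies below `X ∖ {x}`. -/
theorem not_isAtom_of_le_denseFilter [T2Space X] [PerfectSpace X]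
    {A : (raney (Opens X)).FunayamaEnvelope} (hA : A ≤ (raney (Opens X)).embed (denseFilter X)) :
    ¬ IsAtom A := by
  intro hat
  have hdich : ∀ W : Opens X, A ≤ (raney (Opens X)).embed (principal W) ∨
      (raney (Opens X)).embed (principal W) ≤ Aᶜ := by
    intro W
    rcases hat.le_iff.1 (inf_le_left : A ⊓ (raney (Opens X)).embed (principal W) ≤ A) with h | h
    · exact Or.inr (le_compl_iff_disjoint_left.2 (disjoint_iff.2 h))
    · exact Or.inl (inf_eq_left.1 h)
  have hno : ∀ W : Opens X, A ≤ (raney (Opens X)).embed (principal W) →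
      ¬ (raney (Opens X)).embed (principal W) ≤ Aᶜ :=
    fun W h1 h2 => hat.1 (le_compl_self.1 (h1.trans h2))
  have htop : A ≤ (raney (Opens X)).embed (principal ⊤) :=
    hA.trans ((raney (Opens X)).embed_le_embed.2 (le_principal.2 Order.PFilter.top_mem))
  -- Otherwise `X` is covered by opens lying below `Aᶜ`, and then so does their join, the whole
  -- space.
  obtain ⟨x, hx⟩ : ∃ x : X, ∀ W : Opens X, x ∈ W →
      A ≤ (raney (Opens X)).embed (principal W) := by
    by_contra! h
    refine hno ⊤ htop (embed_principal_le fun x _ => ?_)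
    obtain ⟨W, hxW, hW⟩ := h x
    exact ⟨W, hxW, (hdich W).resolve_left hW⟩
  -- `A` is below `X ∖ {x}`, yet this open is covered by opens below `Aᶜ`: each `y ≠ x` has a
  -- neighbourhood disjoint from some `U ∋ x`, and `A ≤ U`.
  refine hno (Opens.complSingleton x) (hA.trans ((raney (Opens X)).embed_le_embed.2
    (le_principal.2 (complSingleton_mem_denseFilter x)))) (embed_principal_le fun y hy => ?_)
  obtain ⟨U, V, hU, hV, hxU, hyV, hd⟩ := t2_separation (fun h : x = y => hy h.symm)
  refine ⟨⟨V, hV⟩, hyV, (hdich _).resolve_left fun h => ?_⟩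
  have h1 := le_inf (hx ⟨U, hU⟩ hxU) h
  rw [← embed_inf] at h1
  refine hat.1 (le_bot_iff.1 (h1.trans ?_))
  rw [le_bot_iff, embed_eq_bot, eq_bot_iff_bot_mem]
  have h2 : (⟨U, hU⟩ ⊓ ⟨V, hV⟩ : Opens X) ∈
      (principal (⟨U, hU⟩ : Opens X) ⊓ principal ⟨V, hV⟩).toPFilter :=
    Order.PFilter.inf_mem (le_principal.1 inf_le_left) (le_principal.1 inf_le_right)
  refine Order.PFilter.mem_of_le ?_ h2
  rintro z ⟨hz1, hz2⟩
  exact (Set.disjoint_left.1 hd hz1 hz2).elim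

/-- The obstruction is purely boolean: powersets are atomic, while the nonzero dense filter has no
atom below it. -/
theorem not_isSpatial [Nonempty X] [T2Space X] [PerfectSpace X] :
    ¬ IsSpatial (StronglyExactEnvelope (Opens X)) := by
  rintro ⟨Y, _, f, _⟩
  have h1 : f ((raney (Opens X)).embed (denseFilter X)) ≠ ∅ := fun h =>
    embed_denseFilter_ne_bot (X := X) (f.injective (h.trans (map_bot f).symm))
  obtain ⟨y, hy⟩ := Set.nonempty_iff_ne_empty.2 h1
  refine not_isAtom_of_le_denseFilter (X := X) (A := f.symm {y}) ?_
    ((f.symm.isAtom_iff _).2 (Set.isAtom_singleton y))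
  rw [← f.le_iff_le, f.apply_symm_apply]
  exact Set.singleton_subset_iff.2 hy

/-- There is no non-zero locally closed element below the smallest dense sublocale. -/
theorem eq_bot_of_isTHalfElement [T1Space X] [PerfectSpace X]
    {A : StronglyExactEnvelope (Opens X)} (hA : IsTHalfElement A)
    (hle : A ≤ (raney (Opens X)).embed (denseFilter X)) : A = ⊥ := by
  obtain ⟨w, hw, c, hc, rfl⟩ := hA
  obtain ⟨_, ⟨U, rfl⟩, rfl⟩ := (raney (Opens X)).mem_opens_iff.1 hw
  obtain ⟨_, ⟨V, rfl⟩, rfl⟩ := (raney (Opens X)).mem_closeds_iff.1 hc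
  rw [embed_inf_compl_le] at hle
  rw [← le_bot_iff, ← embed_bot, embed_inf_compl_le, sup_bot_eq, le_principal, mem_principal]
  intro x hxU
  by_contra hxV
  -- Joins of filters are intersections, and `X ∖ {x}` is dense and contains `V`. From `U ≤ V ⊔ D`,
  -- with `D` the dense filter, it then follows that `U` misses `x`.
  have h1 : Opens.complSingleton x ∈ (principal V ⊔ denseFilter X).toPFilter :=
    mem_sup.2 ⟨mem_principal.2 (Opens.le_complSingleton_iff.2 hxV),
      complSingleton_mem_denseFilter x⟩
  exact Opens.le_complSingleton_iff.1 (mem_principal.1 (le_def.1 hle _ h1)) hxU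

/-- Stated for any set of locally closed elements so that it refutes `T_{1/2}` and `T₂` alike. -/
theorem eq_bot_of_isJoinDense [T1Space X] [PerfectSpace X]
    {S : Set (StronglyExactEnvelope (Opens X))} (hS : ∀ A ∈ S, IsTHalfElement A) :
    IsJoinDense S → (raney (Opens X)).embed (denseFilter X) = ⊥ := by
  intro h
  obtain ⟨T, hT, heq⟩ := h ((raney (Opens X)).embed (denseFilter X))
  rw [heq, sSup_eq_bot]
  exact fun A hA => eq_bot_of_isTHalfElement (hS A (hT hA)) (heq ▸ le_sSup hA)

theorem not_isTHalf [Nonempty X] [T1Space X] [PerfectSpace X] :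
    ¬ IsTHalf (StronglyExactEnvelope (Opens X)) := fun h =>
  embed_denseFilter_ne_bot (eq_bot_of_isJoinDense (fun _ h => h) h)

end StronglyExactFilter

/-! ### `T₂` elements are closed; conclusion -/

namespace RaneyExtension

open MTAlgebra

variable {C : Type u} [Order.Coframe C] (R : RaneyExtension C)

/-- The closed elements of the envelope are closed under meets. -/
theorem sInf_mem_closeds {S : Set R.FunayamaEnvelope} (hS : S ⊆ closeds R.FunayamaEnvelope) :
    sInf S ∈ closeds R.FunayamaEnvelope := by
  refine R.mem_closeds_iff.2 ⟨sSup {w | w ∈ R.carrier ∧ (R.embed w)ᶜ ∈ S},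
    R.sSup_mem _ fun w hw => hw.1, le_antisymm (le_sInf fun A hA => ?_) ?_⟩
  · obtain ⟨w, hw, rfl⟩ := R.mem_closeds_iff.1 (hS hA)
    exact compl_le_compl (R.embed_le_embed.2 (le_sSup ⟨hw, hA⟩))
  · rw [le_compl_comm]
    exact R.embed_sSup_le (fun w hw => hw.1) fun w hw => le_compl_comm.1 (sInf_le hw.2)

/-- A `T₂` element is a meet of closures, hence closed, and so locally closed with open part `⊤`. -/
theorem isTHalfElement_of_isT2Element {A : R.FunayamaEnvelope} (hA : IsT2Element A) :
    IsTHalfElement A := by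
  refine ⟨⊤, ⟨⊤, box_top⟩, A, ?_, (top_inf_eq A).symm⟩
  rw [hA]
  refine R.sInf_mem_closeds ?_
  rintro _ ⟨w, _, _, rfl⟩
  exact ⟨w, rfl⟩

end RaneyExtension

theorem StronglyExactFilter.not_isT2 {X : Type u} [TopologicalSpace X] [Nonempty X] [T1Space X]
    [PerfectSpace X] : ¬ MTAlgebra.IsT2 (StronglyExactEnvelope (TopologicalSpace.Opens X)) :=
  fun h => embed_denseFilter_ne_bot (eq_bot_of_isJoinDense
    (fun _ hA => RaneyExtension.isTHalfElement_of_isT2Element _ hA) h)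

theorem mainTheorem1 {X : Type u} [TopologicalSpace X] [Nonempty X] [LocallyCompactSpace X]
    [T2Space X] [PerfectSpace X] :
    -- the Funayama envelope `M` of `(Filt_SE(Ω(X)), Ω(X))` is locally compact, sober, `T₀` ...
    MTAlgebra.IsLocallyCompact (StronglyExactEnvelope (TopologicalSpace.Opens X)) ∧
      MTAlgebra.IsSober (StronglyExactEnvelope (TopologicalSpace.Opens X)) ∧
      MTAlgebra.IsT0 (StronglyExactEnvelope (TopologicalSpace.Opens X)) ∧
      -- ... and not spatial,
      ¬ MTAlgebra.IsSpatial (StronglyExactEnvelope (TopologicalSpace.Opens X)) ∧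
      -- although its frame of opens is `Ω(X)`, hence spatial (first problem);
      Nonempty (MTAlgebra.OpenFrame (StronglyExactEnvelope (TopologicalSpace.Opens X)) ≃o
          TopologicalSpace.Opens X) ∧
      IsSpatialFrame (MTAlgebra.OpenFrame (StronglyExactEnvelope (TopologicalSpace.Opens X))) ∧
      -- its frame of opens is subfit and Hausdorff, but it is not `T_{1/2}`, nor `T₂`
      -- (second problem)
      IsSubfitFrame (MTAlgebra.OpenFrame (StronglyExactEnvelope (TopologicalSpace.Opens X))) ∧
      IsHausdorffFrame (MTAlgebra.OpenFrame (StronglyExactEnvelope (TopologicalSpace.Opens X))) ∧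
      ¬ MTAlgebra.IsTHalf (StronglyExactEnvelope (TopologicalSpace.Opens X)) ∧
      ¬ MTAlgebra.IsT2 (StronglyExactEnvelope (TopologicalSpace.Opens X)) := by
  have e := StronglyExactFilter.openFrameIso (TopologicalSpace.Opens X)
  exact ⟨StronglyExactFilter.isLocallyCompact, StronglyExactFilter.isSober,
    RaneyExtension.isT0 _, StronglyExactFilter.not_isSpatial, ⟨e.symm⟩,
    ⟨X, inferInstance, ⟨e.symm⟩⟩, TopologicalSpace.Opens.isSubfitFrame.of_orderIso e,
    TopologicalSpace.Opens.isHausdorffFrame.of_orderIso e,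
    StronglyExactFilter.not_isTHalf, StronglyExactFilter.not_isT2⟩
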